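/- Let $k$ be a field of characteristic zero. A \emph{nonunital operad} is a sequence $S=\{S(n)\}_{n\ge 1}$ of $\mathbb Z$-graded $k$-vector spaces with linear degree zero left actions of the symmetric groups $\Sigma_n$ and degree zero linear maps $\circ_i\colon S(m)\otimes S(n)\to S(m+n-1)$, $1\le i\le n$ ($f\circ_i g$ is $f$ inserted into the $i$-th input of $g$), which are equivariant in the usual sense and satisfy, for homogeneous $f\in S(a)$, $g\in S(b)$, $h\in S(c)$, $$f\circ_i(g\circ_j h)=\begin{cases}(-1)^{|f||g|}\,g\circ_{j+a-1}(f\circ_i h), & 1\le i\le j-1,\\ (f\circ_{i-j+1}g)\circ_j h, & j\le i\le b+j-1,\\ (-1)^{|f||g|}\,g\circ_j(f\circ_{i-b+1}h), & i\ge j+b.\end{cases}$$ A \emph{collection} is a sequence $E=\{E(n)\}_{n\ge2}$ of $\mathbb Z$-graded $k$-vector spaces with linear degree zero left $\Sigma_n$-actions; its maps are the equivariant linear maps of degree zero. Let $\mathcal F(E)$ be the free nonunital operad on a collection $E$, and let $\mathcal F^l(E)\subset\mathcal F(E)$ be the span of the composites of exactly $l$ generators, $\mathcal F^{\ge2}(E)=\sum_{l\ge2}\mathcal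 F^l(E)$. For a nonunital operad $S$, let the decomposables $D(S)(n)\subset S(n)$ be the span of all elements $\sigma(f\circ_i g)$ with $f\in S(a)$, $g\in S(b)$, $a,b\ge1$, $a+b-1=n$, $1\le i\le b$, $\sigma\in\Sigma_n$, and let $Q(S)=S/D(S)$ be the indecomposables. Let $S$ be a nonunital operad with $S(1)=0$, and $Q=Q(S)$, $\pi\colon S\to Q$ the projection. Then $\pi$ has an equivariant section (a map of collections $s\colon Q\to S$ with $\pi s=\mathrm{id}$), and for every such $s$ the homomorphism of operads $\alpha\colon\mathcal F(Q)\to S$ with $\alpha|_Q=s$ has the following properties. (i) $\alpha$ is an epimorphism, i.e. each $\alpha(n)$ is surjective. (ii) $\operatorname{Ker}(\alpha)\subset\mathcal F^{\ge2}(Q)=D(\mathcal F(Q))$. (iii) For any collection $Q'$ and any epimorphism of operads $\alpha'\colon\mathcal F(Q')\to S$ (each $\alpha'(n)$ surjective) there is a monomorphism of operads $\beta\colon\mathcal F(Q)\to\mathcal F(Q')$ (each $\beta(n)$ injective) with $\alpha'\circ\beta=\alpha$. -/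

import Mathlib

universe u v w

/-! ### Graded collections -/

/-- A sequence `{E(n) ; n ≥ 1}` of `ℤ`-graded `k`-vector spaces `E(n) = ⨁ₚ E(n)ₚ`, each with a
degree zero `k`-linear left action of the symmetric group `Σₙ`. The homogeneous component
`E(n)ₚ` is `E.obj n p`. -/
structure GrCollection (k : Type u) [Field k] where
  obj : ℕ+ → ℤ → Type v
  [addCommGroup : ∀ n p, AddCommGroup (obj n p)]
  [module : ∀ n p, Module k (obj n p)]
  action : ∀ (n : ℕ+) (p : ℤ), Representation k (Equiv.Perm (Fin n)) (obj n p)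

attribute [instance] GrCollection.addCommGroup GrCollection.module

/-- `E(1) = 0`, i.e. `E` is a sequence indexed by the arities `n ≥ 2`. -/
def GrCollection.IsReduced {k : Type u} [Field k] (E : GrCollection.{u, v} k) : Prop :=
  ∀ (p : ℤ) (x : E.obj 1 p), x = 0

/-- Equivariant maps of collections (linear, of degree zero). -/
structure GrCollection.Hom {k : Type u} [Field k]
    (E : GrCollection.{u, v} k) (F : GrCollection.{u, w} k) where
  toLin : ∀ n p, E.obj n p →ₗ[k] F.obj n p
  map_action : ∀ (n : ℕ+) (p : ℤ) (σ : Equiv.Perm (Fin n)) (x : E.obj n p),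
    toLin n p (E.action n p σ x) = F.action n p σ (toLin n p x)

/-! ### Insertion of permutations -/

/-- The inputs of `f ∘ⱼ g` (`f` of arity `m` plugged into the input `j` of `g`, which has arity
`n`; all inputs are numbered from `0`): the inputs of `g` other than `j`, together with those
of `f`. The inputs of `f` occupy the places `j, …, j + m - 1`. -/
def slotEquiv {m n l : ℕ+} (h : (m : ℕ) + n = l + 1) (j : Fin n) :
    {t : Fin n // t ≠ j} ⊕ Fin m ≃ Fin l where
  toFun
    | Sum.inl t => ⟨if t.1.1 < j.1 then t.1.1 else t.1.1 + m - 1, by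
        have h1 := t.1.2; have h2 := m.pos; have h3 := j.2
        have h4 : t.1.1 ≠ j.1 := fun e => t.2 (Fin.ext e)
        split_ifs <;> omega⟩
    | Sum.inr y => ⟨j.1 + y.1, by have h1 := y.2; have h3 := j.2; omega⟩
  invFun z :=
    if h1 : z.1 < j.1 then Sum.inl ⟨⟨z.1, by have := j.2; omega⟩, by
      intro e; rw [← e] at h1; exact lt_irrefl _ h1⟩
    else if h2 : z.1 < j.1 + m then Sum.inr ⟨z.1 - j.1, by omega⟩
    else Sum.inl ⟨⟨z.1 + 1 - m, by have := z.2; omega⟩, by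
      intro e; have := congrArg Fin.val e; simp only at this; omega⟩
  left_inv s := by
    have h2 := m.pos
    rcases s with ⟨t, ht⟩ | y
    · have h4 : t.1 ≠ j.1 := fun e => ht (Fin.ext e)
      by_cases h1 : t.1 < j.1
      · simp [h1]
      · have h5 : ¬ (t.1 + m - 1 < j.1) := by omega
        have h6 : ¬ (t.1 + m - 1 < j.1 + m) := by omega
        simp only [h1, if_false, h5, h6, dif_neg, not_false_eq_true]
        congr 2
        apply Fin.ext
        simp only
        omega
    · have h5 : ¬ (j.1 + y.1 < j.1) := by omega
      have h6 : j.1 + y.1 < j.1 + m := by have := y.2; omega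
      simp
  right_inv z := by
    have h2 := m.pos
    by_cases h1 : z.1 < j.1
    · simp [h1]
    · by_cases h3 : z.1 < j.1 + m
      · simp only [h1, h3, dif_neg, dif_pos, not_false_eq_true]
        apply Fin.ext
        simp only
        omega
      · have h5 : ¬ (z.1 + 1 - m < j.1) := by omega
        simp only [h1, h3, dif_neg, not_false_eq_true, h5, if_false]
        apply Fin.ext
        simp only
        omega

/-- The permutation of the inputs of `f ∘ⱼ g` obtained by inserting `σ` into `τ`: an input `t` of
`g` is moved to the input `τ t`, and an input `y` of `f` to the input `σ y` of the block which
is now at the place `τ j`. -/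
def insertPerm {m n l : ℕ+} (h : (m : ℕ) + n = l + 1)
    (σ : Equiv.Perm (Fin m)) (τ : Equiv.Perm (Fin n)) (j : Fin n) : Equiv.Perm (Fin l) :=
  ((slotEquiv h j).symm.trans
    (Equiv.sumCongr (τ.subtypeEquiv (fun _ => (τ.injective.ne_iff (y := j)).symm)) σ)).trans
      (slotEquiv h (τ j))

/-! ### Nonunital operads -/

/-- A nonunital (symmetric) operad in graded vector spaces over `k`, in terms of partial
compositions. The element `f ∘ᵢ g`, for `f ∈ S(m)`, `g ∈ S(n)` and an input `i` of `g`, is the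
result of plugging `f` into the input `i` of `g`. It lies in `S(l)`, where `l = m + n - 1`, and is
denoted by `comp h hd i f g`; here `h` and `hd` record the arities and the degrees. Inputs are
numbered from `0`. -/
structure NonunitalOperad (k : Type u) [Field k] extends GrCollection.{u, v} k where
  comp : ∀ {m n l : ℕ+} {p q r : ℤ}, (m : ℕ) + n = l + 1 → p + q = r → Fin n →
    (obj m p →ₗ[k] obj n q →ₗ[k] obj l r)
  /-- `f` is plugged into an input of `h` on the left of `g`. -/
  assoc_left : ∀ {a b c bc ac l : ℕ+} {p q r qr pr t : ℤ}
    (h₁ : (b : ℕ) + c = bc + 1) (h₂ : (a : ℕ) + bc = l + 1)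
    (h₃ : (a : ℕ) + c = ac + 1) (h₄ : (b : ℕ) + ac = l + 1)
    (d₁ : q + r = qr) (d₂ : p + qr = t) (d₃ : p + r = pr) (d₄ : q + pr = t)
    (i j : Fin c) (i' : Fin bc) (j' : Fin ac),
    (i : ℕ) < j → (i' : ℕ) = i → (j' : ℕ) + 1 = j + a →
    ∀ (f : obj a p) (g : obj b q) (h : obj c r),
      comp h₂ d₂ i' f (comp h₁ d₁ j g h) =
        ((-1 : k) ^ (p * q)) • comp h₄ d₄ j' g (comp h₃ d₃ i f h)
  /-- `f` is plugged into an input of `g`. -/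
  assoc_mid : ∀ {a b c bc ab l : ℕ+} {p q r qr pq t : ℤ}
    (h₁ : (b : ℕ) + c = bc + 1) (h₂ : (a : ℕ) + bc = l + 1)
    (h₃ : (a : ℕ) + b = ab + 1) (h₄ : (ab : ℕ) + c = l + 1)
    (d₁ : q + r = qr) (d₂ : p + qr = t) (d₃ : p + q = pq) (d₄ : pq + r = t)
    (i : Fin b) (j : Fin c) (i' : Fin bc), (i' : ℕ) = j + i →
    ∀ (f : obj a p) (g : obj b q) (h : obj c r),
      comp h₂ d₂ i' f (comp h₁ d₁ j g h) = comp h₄ d₄ j (comp h₃ d₃ i f g) h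
  /-- `f` is plugged into an input of `h` on the right of `g`. -/
  assoc_right : ∀ {a b c bc ac l : ℕ+} {p q r qr pr t : ℤ}
    (h₁ : (b : ℕ) + c = bc + 1) (h₂ : (a : ℕ) + bc = l + 1)
    (h₃ : (a : ℕ) + c = ac + 1) (h₄ : (b : ℕ) + ac = l + 1)
    (d₁ : q + r = qr) (d₂ : p + qr = t) (d₃ : p + r = pr) (d₄ : q + pr = t)
    (i j : Fin c) (i' : Fin bc) (j' : Fin ac),
    (j : ℕ) < i → (i' : ℕ) + 1 = i + b → (j' : ℕ) = j →
    ∀ (f : obj a p) (g : obj b q) (h : obj c r),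
      comp h₂ d₂ i' f (comp h₁ d₁ j g h) =
        ((-1 : k) ^ (p * q)) • comp h₄ d₄ j' g (comp h₃ d₃ i f h)
  equivariant : ∀ {m n l : ℕ+} {p q r : ℤ} (h : (m : ℕ) + n = l + 1) (hd : p + q = r)
    (j : Fin n) (σ : Equiv.Perm (Fin m)) (τ : Equiv.Perm (Fin n)) (f : obj m p) (g : obj n q),
      comp h hd (τ j) (action m p σ f) (action n q τ g) =
        action l r (insertPerm h σ τ j) (comp h hd j f g)

/-- Homomorphisms of nonunital operads. -/
structure NonunitalOperad.Hom {k : Type u} [Field k]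
    (S : NonunitalOperad.{u, v} k) (T : NonunitalOperad.{u, w} k)
    extends GrCollection.Hom S.toGrCollection T.toGrCollection where
  map_comp : ∀ {m n l : ℕ+} {p q r : ℤ} (h : (m : ℕ) + n = l + 1) (hd : p + q = r)
    (i : Fin n) (f : S.obj m p) (g : S.obj n q),
      toLin l r (S.comp h hd i f g) = T.comp h hd i (toLin m p f) (toLin n q g)

/-- All components are surjective. -/
def NonunitalOperad.Hom.IsEpi {k : Type u} [Field k]
    {S : NonunitalOperad.{u, v} k} {T : NonunitalOperad.{u, w} k} (φ : S.Hom T) : Prop :=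
  ∀ n p, Function.Surjective (φ.toLin n p)

/-- All components are injective. -/
def NonunitalOperad.Hom.IsMono {k : Type u} [Field k]
    {S : NonunitalOperad.{u, v} k} {T : NonunitalOperad.{u, w} k} (φ : S.Hom T) : Prop :=
  ∀ n p, Function.Injective (φ.toLin n p)

/-! ### Decomposables and indecomposables -/

namespace NonunitalOperad

variable {k : Type u} [Field k] (S : NonunitalOperad.{u, v} k)

/-- The decomposables `D(S)(n)` (in degree `p`): the span of the elements `σ (f ∘ᵢ g)`. -/
def decomposables (n : ℕ+) (p : ℤ) : Submodule k (S.obj n p) :=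
  Submodule.span k {y | ∃ (a b : ℕ+) (d e : ℤ) (h : (a : ℕ) + b = n + 1) (hd : d + e = p)
    (i : Fin b) (f : S.obj a d) (g : S.obj b e) (σ : Equiv.Perm (Fin n)),
      y = S.action n p σ (S.comp h hd i f g)}

theorem decomposables_le_comap (n : ℕ+) (p : ℤ) (σ : Equiv.Perm (Fin n)) :
    S.decomposables n p ≤ (S.decomposables n p).comap (S.action n p σ) := by
  refine Submodule.span_le.2 ?_
  rintro y ⟨a, b, d, e, h, hd, i, f, g, τ, rfl⟩
  refine Submodule.subset_span ⟨a, b, d, e, h, hd, i, f, g, σ * τ, ?_⟩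
  rw [map_mul]
  rfl

/-- The collection `Q(S) = S / D(S)` of indecomposables. -/
def indecomposables : GrCollection.{u, v} k where
  obj n p := S.obj n p ⧸ S.decomposables n p
  action n p :=
    { toFun := fun σ => (S.decomposables n p).mapQ (S.decomposables n p) (S.action n p σ)
        (S.decomposables_le_comap n p σ)
      map_one' := by
        ext y
        simp
      map_mul' := fun σ τ => by
        ext y
        simp }

/-- The natural projection `π : S → Q(S)`. -/
def projection : S.toGrCollection.Hom S.indecomposables where
  toLin n p := (S.decomposables n p).mkQ
  map_action _ _ _ _ := rfl

/-- `s` is an equivariant section of the projection `π : S → Q(S)`. -/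
def IsSection (s : S.indecomposables.Hom S.toGrCollection) : Prop :=
  ∀ n p (y : S.indecomposables.obj n p), S.projection.toLin n p (s.toLin n p y) = y

end NonunitalOperad

/-! ### The free operad -/

namespace FreeOperad

variable {k : Type u} [Field k]

/-- Formal expressions in the elements of a collection `E` and the operations of an operad. -/
inductive Term (E : GrCollection.{u, v} k) : ℕ+ → ℤ → Type (max u v)
  | of {n : ℕ+} {p : ℤ} (y : E.obj n p) : Term E n p
  | zero {n : ℕ+} {p : ℤ} : Term E n p
  | add {n : ℕ+} {p : ℤ} (y z : Term E n p) : Term E n p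
  | smul {n : ℕ+} {p : ℤ} (c : k) (y : Term E n p) : Term E n p
  | act {n : ℕ+} {p : ℤ} (σ : Equiv.Perm (Fin n)) (y : Term E n p) : Term E n p
  | comp {m n l : ℕ+} {p q r : ℤ} (h : (m : ℕ) + n = l + 1) (hd : p + q = r) (i : Fin n)
      (f : Term E m p) (g : Term E n q) : Term E l r

open Term in
/-- The smallest congruence on formal expressions for which the quotient is a nonunital operad and
the inclusion of `E` is a map of collections. -/
inductive Rel (E : GrCollection.{u, v} k) :
    ∀ {n : ℕ+} {p : ℤ}, Term E n p → Term E n p → Prop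
  | refl {n : ℕ+} {p : ℤ} (y : Term E n p) : Rel E y y
  | symm {n : ℕ+} {p : ℤ} {y z : Term E n p} : Rel E y z → Rel E z y
  | trans {n : ℕ+} {p : ℤ} {y z t : Term E n p} : Rel E y z → Rel E z t → Rel E y t
  | add_congr {n : ℕ+} {p : ℤ} {y y' z z' : Term E n p} :
      Rel E y y' → Rel E z z' → Rel E (add y z) (add y' z')
  | smul_congr {n : ℕ+} {p : ℤ} (c : k) {y y' : Term E n p} :
      Rel E y y' → Rel E (smul c y) (smul c y')
  | act_congr {n : ℕ+} {p : ℤ} (σ : Equiv.Perm (Fin n)) {y y' : Term E n p} :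
      Rel E y y' → Rel E (act σ y) (act σ y')
  | comp_congr {m n l : ℕ+} {p q r : ℤ} (h : (m : ℕ) + n = l + 1) (hd : p + q = r) (i : Fin n)
      {f f' : Term E m p} {g g' : Term E n q} :
      Rel E f f' → Rel E g g' → Rel E (comp h hd i f g) (comp h hd i f' g')
  -- each component is a vector space
  | add_assoc {n : ℕ+} {p : ℤ} (y z t : Term E n p) : Rel E (add (add y z) t) (add y (add z t))
  | add_comm {n : ℕ+} {p : ℤ} (y z : Term E n p) : Rel E (add y z) (add z y)
  | zero_add {n : ℕ+} {p : ℤ} (y : Term E n p) : Rel E (add zero y) y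
  | neg_add {n : ℕ+} {p : ℤ} (y : Term E n p) : Rel E (add (smul (-1) y) y) zero
  | smul_add {n : ℕ+} {p : ℤ} (c : k) (y z : Term E n p) :
      Rel E (smul c (add y z)) (add (smul c y) (smul c z))
  | add_smul {n : ℕ+} {p : ℤ} (c d : k) (y : Term E n p) :
      Rel E (smul (c + d) y) (add (smul c y) (smul d y))
  | mul_smul {n : ℕ+} {p : ℤ} (c d : k) (y : Term E n p) :
      Rel E (smul (c * d) y) (smul c (smul d y))
  | one_smul {n : ℕ+} {p : ℤ} (y : Term E n p) : Rel E (smul 1 y) y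
  -- the symmetric groups act linearly
  | act_add {n : ℕ+} {p : ℤ} (σ : Equiv.Perm (Fin n)) (y z : Term E n p) :
      Rel E (act σ (add y z)) (add (act σ y) (act σ z))
  | act_smul {n : ℕ+} {p : ℤ} (σ : Equiv.Perm (Fin n)) (c : k) (y : Term E n p) :
      Rel E (act σ (smul c y)) (smul c (act σ y))
  | act_one {n : ℕ+} {p : ℤ} (y : Term E n p) : Rel E (act 1 y) y
  | act_mul {n : ℕ+} {p : ℤ} (σ τ : Equiv.Perm (Fin n)) (y : Term E n p) :
      Rel E (act (σ * τ) y) (act σ (act τ y))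
  -- the compositions are bilinear
  | comp_add_left {m n l : ℕ+} {p q r : ℤ} (h : (m : ℕ) + n = l + 1) (hd : p + q = r) (i : Fin n)
      (f f' : Term E m p) (g : Term E n q) :
      Rel E (comp h hd i (add f f') g) (add (comp h hd i f g) (comp h hd i f' g))
  | comp_smul_left {m n l : ℕ+} {p q r : ℤ} (h : (m : ℕ) + n = l + 1) (hd : p + q = r) (i : Fin n)
      (c : k) (f : Term E m p) (g : Term E n q) :
      Rel E (comp h hd i (smul c f) g) (smul c (comp h hd i f g))
  | comp_add_right {m n l : ℕ+} {p q r : ℤ} (h : (m : ℕ) + n = l + 1) (hd : p + q = r) (i : Fin n)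
      (f : Term E m p) (g g' : Term E n q) :
      Rel E (comp h hd i f (add g g')) (add (comp h hd i f g) (comp h hd i f g'))
  | comp_smul_right {m n l : ℕ+} {p q r : ℤ} (h : (m : ℕ) + n = l + 1) (hd : p + q = r) (i : Fin n)
      (c : k) (f : Term E m p) (g : Term E n q) :
      Rel E (comp h hd i f (smul c g)) (smul c (comp h hd i f g))
  -- the axioms of a nonunital operad
  | assoc_left {a b c bc ac l : ℕ+} {p q r qr pr t : ℤ}
      (h₁ : (b : ℕ) + c = bc + 1) (h₂ : (a : ℕ) + bc = l + 1)
      (h₃ : (a : ℕ) + c = ac + 1) (h₄ : (b : ℕ) + ac = l + 1)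
      (d₁ : q + r = qr) (d₂ : p + qr = t) (d₃ : p + r = pr) (d₄ : q + pr = t)
      (i j : Fin c) (i' : Fin bc) (j' : Fin ac)
      (hij : (i : ℕ) < j) (hi : (i' : ℕ) = i) (hj : (j' : ℕ) + 1 = j + a)
      (f : Term E a p) (g : Term E b q) (h : Term E c r) :
      Rel E (comp h₂ d₂ i' f (comp h₁ d₁ j g h))
        (smul ((-1 : k) ^ (p * q)) (comp h₄ d₄ j' g (comp h₃ d₃ i f h)))
  | assoc_mid {a b c bc ab l : ℕ+} {p q r qr pq t : ℤ}
      (h₁ : (b : ℕ) + c = bc + 1) (h₂ : (a : ℕ) + bc = l + 1)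
      (h₃ : (a : ℕ) + b = ab + 1) (h₄ : (ab : ℕ) + c = l + 1)
      (d₁ : q + r = qr) (d₂ : p + qr = t) (d₃ : p + q = pq) (d₄ : pq + r = t)
      (i : Fin b) (j : Fin c) (i' : Fin bc) (hi : (i' : ℕ) = j + i)
      (f : Term E a p) (g : Term E b q) (h : Term E c r) :
      Rel E (comp h₂ d₂ i' f (comp h₁ d₁ j g h)) (comp h₄ d₄ j (comp h₃ d₃ i f g) h)
  | assoc_right {a b c bc ac l : ℕ+} {p q r qr pr t : ℤ}
      (h₁ : (b : ℕ) + c = bc + 1) (h₂ : (a : ℕ) + bc = l + 1)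
      (h₃ : (a : ℕ) + c = ac + 1) (h₄ : (b : ℕ) + ac = l + 1)
      (d₁ : q + r = qr) (d₂ : p + qr = t) (d₃ : p + r = pr) (d₄ : q + pr = t)
      (i j : Fin c) (i' : Fin bc) (j' : Fin ac)
      (hij : (j : ℕ) < i) (hi : (i' : ℕ) + 1 = i + b) (hj : (j' : ℕ) = j)
      (f : Term E a p) (g : Term E b q) (h : Term E c r) :
      Rel E (comp h₂ d₂ i' f (comp h₁ d₁ j g h))
        (smul ((-1 : k) ^ (p * q)) (comp h₄ d₄ j' g (comp h₃ d₃ i f h)))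
  | equivariant {m n l : ℕ+} {p q r : ℤ} (h : (m : ℕ) + n = l + 1) (hd : p + q = r)
      (j : Fin n) (σ : Equiv.Perm (Fin m)) (τ : Equiv.Perm (Fin n))
      (f : Term E m p) (g : Term E n q) :
      Rel E (comp h hd (τ j) (act σ f) (act τ g)) (act (insertPerm h σ τ j) (comp h hd j f g))
  -- the inclusion of `E` is a map of collections
  | of_add {n : ℕ+} {p : ℤ} (y z : E.obj n p) : Rel E (of (y + z)) (add (of y) (of z))
  | of_smul {n : ℕ+} {p : ℤ} (c : k) (y : E.obj n p) : Rel E (of (c • y)) (smul c (of y))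
  | of_act {n : ℕ+} {p : ℤ} (σ : Equiv.Perm (Fin n)) (y : E.obj n p) :
      Rel E (of (E.action n p σ y)) (act σ (of y))

variable (E : GrCollection.{u, v} k)

instance setoid (n : ℕ+) (p : ℤ) : Setoid (Term E n p) :=
  ⟨Rel E, Rel.refl, Rel.symm, Rel.trans⟩

/-- The component of arity `n` and degree `p` of the free operad on `E`. -/
def Carrier (n : ℕ+) (p : ℤ) : Type (max u v) := Quotient (setoid E n p)

variable {n : ℕ+} {p : ℤ}

instance : Zero (Carrier E n p) := ⟨Quotient.mk _ Term.zero⟩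
instance : Add (Carrier E n p) :=
  ⟨Quotient.map₂ Term.add fun _ _ h₁ _ _ h₂ => Rel.add_congr h₁ h₂⟩
instance : SMul k (Carrier E n p) :=
  ⟨fun c => Quotient.map (Term.smul c) fun _ _ h => Rel.smul_congr c h⟩
instance : Neg (Carrier E n p) := ⟨fun y => (-1 : k) • y⟩

instance : AddCommGroup (Carrier E n p) where
  add_assoc := by
    rintro ⟨a⟩ ⟨b⟩ ⟨c⟩
    exact Quotient.sound (Rel.add_assoc a b c)
  zero_add := by
    rintro ⟨a⟩
    exact Quotient.sound (Rel.zero_add a)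
  add_zero := by
    rintro ⟨a⟩
    exact Quotient.sound (Rel.trans (Rel.add_comm _ _) (Rel.zero_add a))
  nsmul := nsmulRec
  zsmul := zsmulRec
  neg_add_cancel := by
    rintro ⟨a⟩
    exact Quotient.sound (Rel.neg_add a)
  add_comm := by
    rintro ⟨a⟩ ⟨b⟩
    exact Quotient.sound (Rel.add_comm a b)

instance : Module k (Carrier E n p) :=
  Module.ofMinimalAxioms
    (by rintro c ⟨y⟩ ⟨z⟩; exact Quotient.sound (Rel.smul_add c y z))
    (by rintro c d ⟨y⟩; exact Quotient.sound (Rel.add_smul c d y))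
    (by rintro c d ⟨y⟩; exact Quotient.sound (Rel.mul_smul c d y))
    (by rintro ⟨y⟩; exact Quotient.sound (Rel.one_smul y))

/-- The action of the symmetric groups on the free operad. -/
def action (n : ℕ+) (p : ℤ) : Representation k (Equiv.Perm (Fin n)) (Carrier E n p) where
  toFun σ :=
    { toFun := Quotient.map (Term.act σ) fun _ _ h => Rel.act_congr σ h
      map_add' := by
        rintro ⟨y⟩ ⟨z⟩
        exact Quotient.sound (Rel.act_add σ y z)
      map_smul' := by
        rintro c ⟨y⟩
        exact Quotient.sound (Rel.act_smul σ c y) }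
  map_one' := by
    ext ⟨y⟩
    exact Quotient.sound (Rel.act_one y)
  map_mul' σ τ := by
    ext ⟨y⟩
    exact Quotient.sound (Rel.act_mul σ τ y)

/-- The compositions of the free operad. -/
def comp {m n l : ℕ+} {p q r : ℤ} (h : (m : ℕ) + n = l + 1) (hd : p + q = r) (i : Fin n) :
    Carrier E m p →ₗ[k] Carrier E n q →ₗ[k] Carrier E l r :=
  LinearMap.mk₂ k
    (Quotient.map₂ (Term.comp h hd i) fun _ _ h₁ _ _ h₂ => Rel.comp_congr h hd i h₁ h₂)
    (by rintro ⟨f⟩ ⟨f'⟩ ⟨g⟩; exact Quotient.sound (Rel.comp_add_left h hd i f f' g))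
    (by rintro c ⟨f⟩ ⟨g⟩; exact Quotient.sound (Rel.comp_smul_left h hd i c f g))
    (by rintro ⟨f⟩ ⟨g⟩ ⟨g'⟩; exact Quotient.sound (Rel.comp_add_right h hd i f g g'))
    (by rintro c ⟨f⟩ ⟨g⟩; exact Quotient.sound (Rel.comp_smul_right h hd i c f g))

end FreeOperad

open FreeOperad in
/-- The free nonunital operad `F(E)` on the collection `E`. -/
def FreeOperad {k : Type u} [Field k] (E : GrCollection.{u, v} k) :
    NonunitalOperad.{u, max u v} k where
  obj := Carrier E
  action := action E
  comp := comp E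
  assoc_left := by
    rintro a b c bc ac l p q r qr pr t h₁ h₂ h₃ h₄ d₁ d₂ d₃ d₄ i j i' j' hij hi hj ⟨f⟩ ⟨g⟩ ⟨h⟩
    exact Quotient.sound (Rel.assoc_left h₁ h₂ h₃ h₄ d₁ d₂ d₃ d₄ i j i' j' hij hi hj f g h)
  assoc_mid := by
    rintro a b c bc ab l p q r qr pq t h₁ h₂ h₃ h₄ d₁ d₂ d₃ d₄ i j i' hi ⟨f⟩ ⟨g⟩ ⟨h⟩
    exact Quotient.sound (Rel.assoc_mid h₁ h₂ h₃ h₄ d₁ d₂ d₃ d₄ i j i' hi f g h)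
  assoc_right := by
    rintro a b c bc ac l p q r qr pr t h₁ h₂ h₃ h₄ d₁ d₂ d₃ d₄ i j i' j' hij hi hj ⟨f⟩ ⟨g⟩ ⟨h⟩
    exact Quotient.sound (Rel.assoc_right h₁ h₂ h₃ h₄ d₁ d₂ d₃ d₄ i j i' j' hij hi hj f g h)
  equivariant := by
    rintro m n l p q r h hd j σ τ ⟨f⟩ ⟨g⟩
    exact Quotient.sound (Rel.equivariant h hd j σ τ f g)

namespace FreeOperad

variable {k : Type u} [Field k]

/-- The inclusion of generators `E → F(E)`. -/
def of (E : GrCollection.{u, v} k) : E.Hom (FreeOperad E).toGrCollection where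
  toLin n p :=
    { toFun := fun y => (Quotient.mk _ (Term.of y) : Carrier E n p)
      map_add' := fun y z => Quotient.sound (Rel.of_add y z)
      map_smul' := fun c y => Quotient.sound (Rel.of_smul c y) }
  map_action _ _ σ y := Quotient.sound (Rel.of_act σ y)

variable {E : GrCollection.{u, v} k} {T : NonunitalOperad.{u, w} k}

/-- The value of a formal expression in an operad `T`, given the values of the generators. -/
def Term.eval (s : E.Hom T.toGrCollection) : ∀ {n : ℕ+} {p : ℤ}, Term E n p → T.obj n p
  | _, _, .of y => s.toLin _ _ y
  | _, _, .zero => 0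
  | _, _, .add y z => y.eval s + z.eval s
  | _, _, .smul c y => c • y.eval s
  | _, _, .act σ y => T.action _ _ σ (y.eval s)
  | _, _, .comp h hd i f g => T.comp h hd i (f.eval s) (g.eval s)

theorem Rel.eval_eq (s : E.Hom T.toGrCollection) {n : ℕ+} {p : ℤ} {y z : Term E n p}
    (h : Rel E y z) : y.eval s = z.eval s := by
  induction h with
  | refl => rfl
  | symm _ ih => exact ih.symm
  | trans _ _ ih₁ ih₂ => exact ih₁.trans ih₂
  | add_congr _ _ ih₁ ih₂ => simp only [Term.eval, ih₁, ih₂]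
  | smul_congr _ _ ih => simp only [Term.eval, ih]
  | act_congr _ _ ih => simp only [Term.eval, ih]
  | comp_congr _ _ _ _ _ ih₁ ih₂ => simp only [Term.eval, ih₁, ih₂]
  | add_assoc => exact _root_.add_assoc _ _ _
  | add_comm => exact _root_.add_comm _ _
  | zero_add => exact _root_.zero_add _
  | neg_add => simp [Term.eval]
  | smul_add => exact _root_.smul_add _ _ _
  | add_smul => exact _root_.add_smul _ _ _
  | mul_smul => exact SemigroupAction.mul_smul _ _ _
  | one_smul => exact _root_.one_smul _ _
  | act_add => simp [Term.eval]
  | act_smul => simp [Term.eval]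
  | act_one => simp [Term.eval]
  | act_mul => simp [Term.eval]
  | comp_add_left => simp [Term.eval]
  | comp_smul_left => simp [Term.eval]
  | comp_add_right => simp [Term.eval]
  | comp_smul_right => simp [Term.eval]
  | assoc_left h₁ h₂ h₃ h₄ d₁ d₂ d₃ d₄ i j i' j' hij hi hj f g h =>
    exact T.assoc_left h₁ h₂ h₃ h₄ d₁ d₂ d₃ d₄ i j i' j' hij hi hj _ _ _
  | assoc_mid h₁ h₂ h₃ h₄ d₁ d₂ d₃ d₄ i j i' hi f g h =>
    exact T.assoc_mid h₁ h₂ h₃ h₄ d₁ d₂ d₃ d₄ i j i' hi _ _ _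
  | assoc_right h₁ h₂ h₃ h₄ d₁ d₂ d₃ d₄ i j i' j' hij hi hj f g h =>
    exact T.assoc_right h₁ h₂ h₃ h₄ d₁ d₂ d₃ d₄ i j i' j' hij hi hj _ _ _
  | equivariant h hd j σ τ f g => exact T.equivariant h hd j σ τ _ _
  | of_add => simp [Term.eval]
  | of_smul => simp [Term.eval]
  | of_act => exact s.map_action _ _ _ _

/-- The unique homomorphism `F(E) → T` of operads which restricts to `s` on `E`. -/
def lift (s : E.Hom T.toGrCollection) : (FreeOperad E).Hom T where
  toLin n p :=
    { toFun := Quotient.lift (Term.eval s) fun _ _ h => Rel.eval_eq s h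
      map_add' := by
        rintro ⟨y⟩ ⟨z⟩
        rfl
      map_smul' := by
        rintro c ⟨y⟩
        rfl }
  map_action := by
    rintro n p σ ⟨y⟩
    rfl
  map_comp := by
    rintro m n l p q r h hd i ⟨f⟩ ⟨g⟩
    rfl

theorem lift_of (s : E.Hom T.toGrCollection) (n : ℕ+) (p : ℤ) (y : E.obj n p) :
    (lift s).toLin n p ((of E).toLin n p y) = s.toLin n p y := rfl

theorem lift_unique (s : E.Hom T.toGrCollection) (φ : (FreeOperad E).Hom T)
    (hφ : ∀ n p (y : E.obj n p), φ.toLin n p ((of E).toLin n p y) = s.toLin n p y) :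
    φ = lift s := by
  have key : ∀ (n : ℕ+) (p : ℤ) (y : Term E n p),
      φ.toLin n p (Quotient.mk _ y : Carrier E n p) = y.eval s := by
    intro n p y
    induction y with
    | of y => exact hφ _ _ y
    | zero => exact map_zero _
    | add y z ihy ihz =>
      exact ((φ.toLin _ _).map_add (Quotient.mk _ y : Carrier E _ _)
        (Quotient.mk _ z : Carrier E _ _)).trans
        (congrArg₂ (· + ·) ihy ihz)
    | smul c y ih =>
      exact ((φ.toLin _ _).map_smul c (Quotient.mk _ y : Carrier E _ _)).trans
        (congrArg (c • ·) ih)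
    | act σ y ih =>
      exact (φ.map_action _ _ σ (Quotient.mk _ y : Carrier E _ _)).trans
        (congrArg (T.action _ _ σ) ih)
    | comp h hd i f g ihf ihg =>
      refine (φ.map_comp h hd i (Quotient.mk _ f : Carrier E _ _)
        (Quotient.mk _ g : Carrier E _ _)).trans ?_
      rw [ihf, ihg]
      rfl
  have h : φ.toLin = (lift s).toLin := by
    funext n p
    ext ⟨y⟩
    exact key n p y
  obtain ⟨⟨φ₀, _⟩, _⟩ := φ
  have h' : φ₀ = (lift s).toLin := h
  subst h'
  rfl

variable (E) in
/-- The elements of `F^d(E)`: linear combinations of composites of exactly `d` generators. -/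
inductive HasWeight : ℕ → ∀ {n : ℕ+} {p : ℤ}, (FreeOperad E).obj n p → Prop
  | of {n : ℕ+} {p : ℤ} (y : E.obj n p) : HasWeight 1 ((of E).toLin n p y)
  | zero {d : ℕ} {n : ℕ+} {p : ℤ} : HasWeight d (0 : (FreeOperad E).obj n p)
  | add {d : ℕ} {n : ℕ+} {p : ℤ} {y z : (FreeOperad E).obj n p} :
      HasWeight d y → HasWeight d z → HasWeight d (y + z)
  | smul {d : ℕ} {n : ℕ+} {p : ℤ} (c : k) {y : (FreeOperad E).obj n p} :
      HasWeight d y → HasWeight d (c • y)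
  | act {d : ℕ} {n : ℕ+} {p : ℤ} (σ : Equiv.Perm (Fin n)) {y : (FreeOperad E).obj n p} :
      HasWeight d y → HasWeight d ((FreeOperad E).action n p σ y)
  | comp {d e : ℕ} {m n l : ℕ+} {p q r : ℤ} (h : (m : ℕ) + n = l + 1) (hd : p + q = r)
      (i : Fin n) {f : (FreeOperad E).obj m p} {g : (FreeOperad E).obj n q} :
      HasWeight d f → HasWeight e g → HasWeight (d + e) ((FreeOperad E).comp h hd i f g)

variable (E) in
/-- The weight component `F^d(E)(n)` (in degree `p`). -/
def weight (d : ℕ) (n : ℕ+) (p : ℤ) : Submodule k ((FreeOperad E).obj n p) where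
  carrier := {y | HasWeight E d y}
  add_mem' := HasWeight.add
  zero_mem' := HasWeight.zero
  smul_mem' c _ := HasWeight.smul c

variable (E) in
/-- `F^{≥ d}(E)(n)` (in degree `p`). -/
def weightGE (d : ℕ) (n : ℕ+) (p : ℤ) : Submodule k ((FreeOperad E).obj n p) :=
  ⨆ e ≥ d, weight E e n p

end FreeOperad

/-! ### Equivariant lifting -/

/-! In characteristic zero, averaging over the finite groups `Σₙ` makes a linear lift through an
equivariant surjection equivariant. This gives the section `s`, and later a lift of `s` through
`α'`. Write `α` for `lift s`. (i) Each `x` differs from `s (π x)` by a decomposable. As `S(1) = 0`,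
decomposables are spanned by composites of elements of smaller arity, so induction on the arity
applies (`isEpi_lift`). (ii) Write an element of the kernel as a generator `y` plus a decomposable.
Applying `π ∘ α` leaves `y = 0` (`ker_lift_le_decomposables`). (iii) Lift `s` to `t : Q → F(Q')` and
let `β` extend `t`. To see that `β` is injective, define `γ : F(Q') → F(Q)` on generators by `z ↦ π
(α' z)`. Then `γ ∘ β` is the identity on generators modulo decomposables, so it moves an element of
weight `≥ d` only by terms of weight `≥ d + 1`. Since `Q(1) = 0`, the weight filtration is finite in
each arity, hence `γ ∘ β` is injective (`isMono_of_map_sub_self_mem`), and so is `β`. -/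

/-- Over a field of characteristic zero, equivariant maps of representations of a finite group lift
through equivariant surjections. -/
theorem Representation.exists_equivariant_lift {k G V W U : Type*} [Field k] [CharZero k]
    [Group G] [Finite G] [AddCommGroup V] [Module k V] [AddCommGroup W] [Module k W]
    [AddCommGroup U] [Module k U] (ρV : Representation k G V) (ρW : Representation k G W)
    (ρU : Representation k G U) (f : W →ₗ[k] U) (hf : ∀ σ x, f (ρW σ x) = ρU σ (f x))
    (hsurj : Function.Surjective f) (s : V →ₗ[k] U) (hs : ∀ σ x, s (ρV σ x) = ρU σ (s x)) :
    ∃ t : V →ₗ[k] W, (∀ σ x, t (ρV σ x) = ρW σ (t x)) ∧ ∀ x, f (t x) = s x := by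
  cases nonempty_fintype G
  obtain ⟨g, hg⟩ := f.exists_rightInverse_of_surjective (LinearMap.range_eq_top.2 hsurj)
  have hg' : ∀ u, f (g u) = u := fun u => LinearMap.congr_fun hg u
  -- The average of the conjugates of `g ∘ s`, where `g` is a merely linear section of `f`.
  refine ⟨(Fintype.card G : k)⁻¹ • ∑ τ : G, ρW τ ∘ₗ g ∘ₗ s ∘ₗ ρV τ⁻¹, fun σ x => ?_, fun x => ?_⟩
  · simp only [LinearMap.smul_apply, LinearMap.sum_apply, LinearMap.comp_apply, map_smul, map_sum]
    congr 1
    -- Reindexing by `τ ↦ σ * τ` moves `σ` outside the sum.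
    refine (Fintype.sum_equiv (Equiv.mulLeft σ) _ _ fun τ => ?_).symm
    simp only [Equiv.coe_mulLeft, mul_inv_rev, map_mul, Module.End.mul_apply]
    rw [← Module.End.mul_apply (ρV σ⁻¹), ← map_mul, inv_mul_cancel, map_one, Module.End.one_apply]
  · have hterm : ∀ τ : G, f (ρW τ (g (s (ρV τ⁻¹ x)))) = s x := fun τ => by
      rw [hf, hg', ← hs, ← Module.End.mul_apply, ← map_mul, mul_inv_cancel, map_one,
        Module.End.one_apply]
    simp only [LinearMap.smul_apply, LinearMap.sum_apply, LinearMap.comp_apply, map_smul, map_sum,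
      hterm, Finset.sum_const, Finset.card_univ]
    rw [← Nat.cast_smul_eq_nsmul k, smul_smul, inv_mul_cancel₀ (by simp), one_smul]

namespace GrCollection.Hom

variable {k : Type*} [Field k]

/-- The composition of maps of collections. -/
def trans {E F G : GrCollection k} (φ : E.Hom F) (ψ : F.Hom G) : E.Hom G where
  toLin n p := ψ.toLin n p ∘ₗ φ.toLin n p
  map_action n p σ x := by
    simp only [LinearMap.comp_apply, φ.map_action, ψ.map_action]

/-- In characteristic zero, maps of collections lift through surjections. -/
theorem exists_lift [CharZero k] {V W U : GrCollection k} (f : W.Hom U)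
    (hf : ∀ n p, Function.Surjective (f.toLin n p)) (s : V.Hom U) :
    ∃ t : V.Hom W, ∀ n p x, f.toLin n p (t.toLin n p x) = s.toLin n p x := by
  choose t ht₁ ht₂ using fun n p => Representation.exists_equivariant_lift (V.action n p)
    (W.action n p) (U.action n p) (f.toLin n p) (f.map_action n p) (hf n p) (s.toLin n p)
    (s.map_action n p)
  exact ⟨⟨t, ht₁⟩, ht₂⟩

end GrCollection.Hom

/-! ### Decomposables and indecomposables of an operad -/

namespace NonunitalOperad

variable {k : Type*} [Field k] {S T : NonunitalOperad k}

theorem comp_mem_decomposables {m n l : ℕ+} {p q r : ℤ} (h : (m : ℕ) + n = l + 1)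
    (hd : p + q = r) (i : Fin n) (f : S.obj m p) (g : S.obj n q) :
    S.comp h hd i f g ∈ S.decomposables l r :=
  Submodule.subset_span ⟨m, n, p, q, h, hd, i, f, g, 1, by simp⟩

theorem Hom.map_mem_decomposables (φ : S.Hom T) {n : ℕ+} {p : ℤ} {x : S.obj n p}
    (hx : x ∈ S.decomposables n p) : φ.toLin n p x ∈ T.decomposables n p := by
  suffices h : S.decomposables n p ≤ (T.decomposables n p).comap (φ.toLin n p) from h hx
  refine Submodule.span_le.2 ?_
  rintro _ ⟨a, b, d, e, h, hd, i, f, g, σ, rfl⟩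
  refine Submodule.subset_span ⟨a, b, d, e, h, hd, i, φ.toLin a d f, φ.toLin b e g, σ, ?_⟩
  rw [φ.map_action, φ.map_comp]

/-- In an operad with `S(1) = 0`, the decomposables of arity `n` are spanned by composites of
elements of arity less than `n`. -/
theorem decomposables_le_of_isReduced (hS : S.IsReduced) {n : ℕ+} {p : ℤ}
    {N : Submodule k (S.obj n p)}
    (hN : ∀ (a b : ℕ+) (d e : ℤ) (h : (a : ℕ) + b = n + 1) (hd : d + e = p) (i : Fin b)
      (f : S.obj a d) (g : S.obj b e) (σ : Equiv.Perm (Fin n)), a < n → b < n →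
      S.action n p σ (S.comp h hd i f g) ∈ N) :
    S.decomposables n p ≤ N := by
  refine Submodule.span_le.2 ?_
  rintro _ ⟨a, b, d, e, h, hd, i, f, g, σ, rfl⟩
  -- A factor of arity one is zero. Otherwise `a, b ≥ 2`, and `a + b = n + 1` makes both smaller
  -- than `n`.
  rcases eq_or_ne a 1 with rfl | ha
  · simp [hS d f]
  rcases eq_or_ne b 1 with rfl | hb
  · simp [hS e g]
  have ha' : (a : ℕ) ≠ 1 := fun h => ha (PNat.coe_eq_one_iff.1 h)
  have hb' : (b : ℕ) ≠ 1 := fun h => hb (PNat.coe_eq_one_iff.1 h)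
  have := a.pos
  have := b.pos
  refine hN a b d e h hd i f g σ ?_ ?_ <;> rw [← PNat.coe_lt_coe] <;> omega

theorem isReduced_indecomposables (hS : S.IsReduced) : S.indecomposables.IsReduced := by
  intro p x
  obtain ⟨y, rfl⟩ := Submodule.mkQ_surjective _ x
  rw [hS p y]
  exact map_zero _

theorem projection_eq_zero_iff {n : ℕ+} {p : ℤ} {x : S.obj n p} :
    S.projection.toLin n p x = 0 ↔ x ∈ S.decomposables n p :=
  Submodule.Quotient.mk_eq_zero _

theorem exists_isSection [CharZero k] (S : NonunitalOperad k) :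
    ∃ s : S.indecomposables.Hom S.toGrCollection, S.IsSection s :=
  GrCollection.Hom.exists_lift S.projection (fun _ _ => Submodule.mkQ_surjective _)
    -- A section is a lift of the identity of `Q(S)` through `π`.
    ⟨fun _ _ => LinearMap.id, fun _ _ _ _ => rfl⟩

end NonunitalOperad

namespace FreeOperad

open NonunitalOperad

variable {k : Type*} [Field k] {E : GrCollection k}

@[elab_as_elim]
theorem induction_on {motive : ∀ {n : ℕ+} {p : ℤ}, (FreeOperad E).obj n p → Prop}
    {n : ℕ+} {p : ℤ} (x : (FreeOperad E).obj n p)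
    (of : ∀ {n p} (y : E.obj n p), motive ((of E).toLin n p y))
    (zero : ∀ {n p}, motive (0 : (FreeOperad E).obj n p))
    (add : ∀ {n p} (y z : (FreeOperad E).obj n p), motive y → motive z → motive (y + z))
    (smul : ∀ {n p} (c : k) (y : (FreeOperad E).obj n p), motive y → motive (c • y))
    (act : ∀ {n : ℕ+} {p : ℤ} (σ : Equiv.Perm (Fin n)) (y : (FreeOperad E).obj n p), motive y →
      motive ((FreeOperad E).action n p σ y))
    (comp : ∀ {m n l : ℕ+} {p q r : ℤ} (h : (m : ℕ) + n = l + 1) (hd : p + q = r) (i : Fin n)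
      (f : (FreeOperad E).obj m p) (g : (FreeOperad E).obj n q), motive f → motive g →
      motive ((FreeOperad E).comp h hd i f g)) : motive x := by
  obtain ⟨x, rfl⟩ := Quotient.exists_rep x
  induction x with
  | of y => exact of y
  | zero => exact zero
  | add y z hy hz => exact add _ _ hy hz
  | smul c y hy => exact smul c _ hy
  | act σ y hy => exact act σ _ hy
  | comp h hd i f g hf hg => exact comp h hd i _ _ hf hg

/-! ### The weight filtration -/

theorem HasWeight.mem_weightGE {d e : ℕ} (hde : d ≤ e) {n : ℕ+} {p : ℤ}
    {x : (FreeOperad E).obj n p} (hx : HasWeight E e x) : x ∈ weightGE E d n p :=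
  Submodule.mem_iSup_of_mem e (Submodule.mem_iSup_of_mem hde hx)

theorem weightGE_le {d : ℕ} {n : ℕ+} {p : ℤ} {N : Submodule k ((FreeOperad E).obj n p)}
    (hN : ∀ e ≥ d, ∀ x, HasWeight E e x → x ∈ N) : weightGE E d n p ≤ N :=
  iSup₂_le fun e he x hx => hN e he x hx

theorem weightGE_anti {d e : ℕ} (hde : d ≤ e) (n : ℕ+) (p : ℤ) :
    weightGE E e n p ≤ weightGE E d n p :=
  weightGE_le fun _ he' _ hx => hx.mem_weightGE (hde.trans he')

theorem action_mem_weightGE {d : ℕ} {n : ℕ+} {p : ℤ} (σ : Equiv.Perm (Fin n))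
    {x : (FreeOperad E).obj n p} (hx : x ∈ weightGE E d n p) :
    (FreeOperad E).action n p σ x ∈ weightGE E d n p := by
  suffices h : weightGE E d n p ≤ (weightGE E d n p).comap ((FreeOperad E).action n p σ) from h hx
  exact weightGE_le fun e he y hy => (hy.act σ).mem_weightGE he

theorem comp_mem_weightGE {d e : ℕ} {m n l : ℕ+} {p q r : ℤ} (h : (m : ℕ) + n = l + 1)
    (hd : p + q = r) (i : Fin n) {f : (FreeOperad E).obj m p} {g : (FreeOperad E).obj n q}
    (hf : f ∈ weightGE E d m p) (hg : g ∈ weightGE E e n q) :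
    (FreeOperad E).comp h hd i f g ∈ weightGE E (d + e) l r := by
  -- By bilinearity the two arguments can be reduced to elements of pure weight one at a time.
  suffices h₁ : weightGE E d m p ≤
      (weightGE E (d + e) l r).comap (((FreeOperad E).comp h hd i).flip g) from h₁ hf
  refine weightGE_le fun d' hd' f' hf' => ?_
  suffices h₂ : weightGE E e n q ≤
      (weightGE E (d + e) l r).comap ((FreeOperad E).comp h hd i f') from h₂ hg
  exact weightGE_le fun e' he' g' hg' => (hf'.comp h hd i hg').mem_weightGE (add_le_add hd' he')

theorem mem_weightGE_one {n : ℕ+} {p : ℤ} (x : (FreeOperad E).obj n p) :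
    x ∈ weightGE E 1 n p := by
  induction x using induction_on with
  | of y => exact (HasWeight.of y).mem_weightGE le_rfl
  | zero => exact zero_mem _
  | add y z hy hz => exact add_mem hy hz
  | smul c y hy => exact Submodule.smul_mem _ c hy
  | act σ y hy => exact action_mem_weightGE σ hy
  | comp h hd i f g hf hg =>
    exact weightGE_anti (by omega) _ _ (comp_mem_weightGE h hd i hf hg)

/-- A composite of at least two generators cannot be a bare generator, so an operadic composition
occurs in it. Conversely each factor of `f ∘ᵢ g` has weight at least one. -/
theorem weightGE_two_eq_decomposables (n : ℕ+) (p : ℤ) :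
    weightGE E 2 n p = (FreeOperad E).decomposables n p := by
  refine le_antisymm (weightGE_le fun e he x hx => ?_) (Submodule.span_le.2 ?_)
  · induction hx with
    | of y => omega
    | zero => exact zero_mem _
    | add _ _ hy hz => exact add_mem (hy he) (hz he)
    | smul c _ hy => exact Submodule.smul_mem _ c (hy he)
    | act σ _ hy => exact (FreeOperad E).decomposables_le_comap _ _ σ (hy he)
    | comp h hd i => exact comp_mem_decomposables h hd i _ _
  · rintro _ ⟨a, b, d, e, h, hd, i, f, g, σ, rfl⟩
    exact action_mem_weightGE σ
      (comp_mem_weightGE (d := 1) (e := 1) h hd i (mem_weightGE_one f) (mem_weightGE_one g))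

/-- The filtration by weight is finite in each arity if there are no generators of arity one. -/
theorem weightGE_eq_bot (hE : E.IsReduced) (n : ℕ+) (p : ℤ) : weightGE E n n p = ⊥ := by
  refine le_bot_iff.1 (weightGE_le fun e he x hx => (Submodule.mem_bot k).2 ?_)
  induction hx with
  | @of n p y =>
    obtain rfl : n = 1 := PNat.coe_eq_one_iff.1 (le_antisymm he n.pos)
    rw [hE p y, map_zero]
  | zero => rfl
  | add _ _ hy hz => rw [hy he, hz he, add_zero]
  | smul c _ hy => rw [hy he, smul_zero]
  | act σ _ hy => rw [hy he, map_zero]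
  | @comp d e m n l p q r h hd i f g _ _ hf hg =>
    -- From `m + n = l + 1` and `l ≤ d + e`, either `m ≤ d` or `n ≤ e`, so one of the factors
    -- already vanishes.
    rcases le_or_gt (m : ℕ) d with hm | hm
    · rw [hf hm, map_zero, LinearMap.zero_apply]
    · rw [hg (by omega), map_zero]

/-- Every element of the free operad is the sum of a generator and a decomposable element. -/
theorem exists_sub_of_mem_decomposables {n : ℕ+} {p : ℤ} (x : (FreeOperad E).obj n p) :
    ∃ y : E.obj n p, x - (of E).toLin n p y ∈ (FreeOperad E).decomposables n p := by
  induction x using induction_on with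
  | of y => exact ⟨y, by rw [sub_self]; exact zero_mem _⟩
  | zero => exact ⟨0, by rw [map_zero, sub_zero]; exact zero_mem _⟩
  | add y z hy hz =>
    obtain ⟨y', hy⟩ := hy
    obtain ⟨z', hz⟩ := hz
    exact ⟨y' + z', by rw [map_add, add_sub_add_comm]; exact add_mem hy hz⟩
  | smul c y hy =>
    obtain ⟨y', hy⟩ := hy
    exact ⟨c • y', by rw [map_smul, ← smul_sub]; exact Submodule.smul_mem _ c hy⟩
  | act σ y hy =>
    obtain ⟨y', hy⟩ := hy
    refine ⟨E.action _ _ σ y', ?_⟩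
    rw [(of E).map_action, ← map_sub]
    exact (FreeOperad E).decomposables_le_comap _ _ σ hy
  | comp h hd i f g =>
    exact ⟨0, by rw [map_zero, sub_zero]; exact comp_mem_decomposables h hd i f g⟩

/-! ### Endomorphisms which are the identity on generators modulo decomposables -/

/-- On composites the difference telescopes as `φf ∘ φg - f ∘ g = (φf - f) ∘ φg + f ∘ (φg - g)`, and
in each summand one factor gains a weight. -/
theorem map_sub_self_mem_of_hasWeight
    {φ : (FreeOperad E).Hom (FreeOperad E)}
    (hφ : ∀ n p (y : E.obj n p),
      φ.toLin n p ((of E).toLin n p y) - (of E).toLin n p y ∈ weightGE E 2 n p)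
    {d : ℕ} {n : ℕ+} {p : ℤ} {x : (FreeOperad E).obj n p}
    (hx : HasWeight E d x) : φ.toLin n p x - x ∈ weightGE E (d + 1) n p := by
  induction hx with
  | of y => exact hφ _ _ y
  | zero => rw [map_zero, sub_zero]; exact zero_mem _
  | add _ _ hy hz => rw [map_add, add_sub_add_comm]; exact add_mem hy hz
  | smul c _ hy => rw [map_smul, ← smul_sub]; exact Submodule.smul_mem _ c hy
  | act σ _ hy => rw [φ.map_action, ← map_sub]; exact action_mem_weightGE σ hy
  | @comp d e m n l p q r h hd i f g hf' hg' hf hg =>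
    have hφg : φ.toLin n q g ∈ weightGE E e n q := by
      rw [← sub_add_cancel (φ.toLin n q g) g]
      exact add_mem (weightGE_anti e.le_succ _ _ hg) (hg'.mem_weightGE le_rfl)
    have key : φ.toLin l r ((FreeOperad E).comp h hd i f g) - (FreeOperad E).comp h hd i f g =
        (FreeOperad E).comp h hd i (φ.toLin m p f - f) (φ.toLin n q g) +
          (FreeOperad E).comp h hd i f (φ.toLin n q g - g) := by
      rw [φ.map_comp, map_sub, map_sub, LinearMap.sub_apply]
      abel
    rw [key]
    refine add_mem ?_ (comp_mem_weightGE (d := d) (e := e + 1) h hd i (hf'.mem_weightGE le_rfl) hg)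
    rw [add_right_comm]
    exact comp_mem_weightGE h hd i hf hφg

theorem map_sub_self_mem_weightGE
    {φ : (FreeOperad E).Hom (FreeOperad E)}
    (hφ : ∀ n p (y : E.obj n p),
      φ.toLin n p ((of E).toLin n p y) - (of E).toLin n p y ∈ weightGE E 2 n p)
    {d : ℕ} {n : ℕ+} {p : ℤ} {x : (FreeOperad E).obj n p}
    (hx : x ∈ weightGE E d n p) : φ.toLin n p x - x ∈ weightGE E (d + 1) n p := by
  suffices h : weightGE E d n p ≤
      (weightGE E (d + 1) n p).comap (φ.toLin n p - LinearMap.id) from h hx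
  exact weightGE_le fun e he y hy =>
    weightGE_anti (Nat.succ_le_succ he) _ _ (map_sub_self_mem_of_hasWeight hφ hy)

/-- If `φ x = 0`, then `φ x - x = -x`, so `x` climbs one step of the filtration at a time until it
reaches the zero stage. -/
theorem isMono_of_map_sub_self_mem
    {φ : (FreeOperad E).Hom (FreeOperad E)}
    (hφ : ∀ n p (y : E.obj n p),
      φ.toLin n p ((of E).toLin n p y) - (of E).toLin n p y ∈ weightGE E 2 n p)
    (hE : E.IsReduced) : φ.IsMono := by
  intro n p
  refine (injective_iff_map_eq_zero _).2 fun x hx => ?_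
  have key : ∀ d, x ∈ weightGE E (d + 1) n p := by
    intro d
    induction d with
    | zero => exact mem_weightGE_one x
    | succ d ih => simpa [hx] using map_sub_self_mem_weightGE hφ ih
  have := weightGE_anti (Nat.le_succ n) n p (key n)
  rwa [weightGE_eq_bot hE, Submodule.mem_bot] at this

/-! ### The free operad on the indecomposables -/

variable {S : NonunitalOperad k} {s : S.indecomposables.Hom S.toGrCollection}

theorem isEpi_lift (hS : S.IsReduced) (hs : S.IsSection s) : (lift s).IsEpi := by
  intro n
  induction n using PNat.strongInductionOn with
  | _ n ih =>
  intro p x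
  -- Modulo decomposables, `x` is the image of a generator.
  suffices h : S.decomposables n p ≤ LinearMap.range ((lift s).toLin n p) by
    have hx : x - s.toLin n p (S.projection.toLin n p x) ∈ S.decomposables n p := by
      rw [← projection_eq_zero_iff, map_sub, hs, sub_self]
    have hsx : s.toLin n p (S.projection.toLin n p x) ∈ LinearMap.range ((lift s).toLin n p) :=
      ⟨_, lift_of s n p _⟩
    exact (Submodule.sub_mem_iff_left _ hsx).1 (h hx)
  refine decomposables_le_of_isReduced hS fun a b d e h hd i f g σ ha hb => ?_
  obtain ⟨f, rfl⟩ := ih a ha d f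
  obtain ⟨g, rfl⟩ := ih b hb e g
  exact ⟨(FreeOperad _).action n p σ ((FreeOperad _).comp h hd i f g), by
    rw [(lift s).map_action, (lift s).map_comp]⟩

theorem ker_lift_le_decomposables (hs : S.IsSection s) (n : ℕ+) (p : ℤ) :
    LinearMap.ker ((lift s).toLin n p) ≤ (FreeOperad S.indecomposables).decomposables n p := by
  intro x hx
  obtain ⟨y, hy⟩ := exists_sub_of_mem_decomposables x
  have h := (lift s).map_mem_decomposables hy
  -- Since `α x = 0`, the element `s y` is decomposable, whence `y = π (s y) = 0`.
  rw [map_sub, LinearMap.mem_ker.1 hx, lift_of, zero_sub, neg_mem_iff, ← projection_eq_zero_iff,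
    hs] at h
  rwa [h, map_zero, sub_zero] at hy

theorem exists_isMono_lift [CharZero k] (hS : S.IsReduced) (hs : S.IsSection s)
    {Q' : GrCollection k} (α' : (FreeOperad Q').Hom S) (hα' : α'.IsEpi) :
    ∃ β : (FreeOperad S.indecomposables).Hom (FreeOperad Q'), β.IsMono ∧
      ∀ n p (y : (FreeOperad S.indecomposables).obj n p),
        α'.toLin n p (β.toLin n p y) = (lift s).toLin n p y := by
  obtain ⟨t, ht⟩ := GrCollection.Hom.exists_lift α'.toHom hα' s
  -- `γ` need not commute with the maps to `S`; it only has to undo `lift t` on generators modulo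
  -- decomposables.
  let γ := lift ((((of Q').trans α'.toHom).trans S.projection).trans (of S.indecomposables))
  let φ : (FreeOperad S.indecomposables).Hom (FreeOperad S.indecomposables) :=
    ⟨(lift t).toHom.trans γ.toHom, fun h hd i f g => by
      simp only [GrCollection.Hom.trans, LinearMap.comp_apply, Hom.map_comp]⟩
  have hφ : φ.IsMono := by
    refine isMono_of_map_sub_self_mem (fun n p y => ?_) (isReduced_indecomposables hS)
    obtain ⟨z, hz⟩ := exists_sub_of_mem_decomposables (t.toLin n p y)
    -- The generator part `z` of `t y` recovers `y`: `α' (t y) = s y`, and `α'` sends the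
    -- decomposable rest into the kernel of `π`.
    have hzy : S.projection.toLin n p (α'.toLin n p ((of Q').toLin n p z)) = y := by
      have h := projection_eq_zero_iff.2 (α'.map_mem_decomposables hz)
      rw [map_sub, map_sub, ht, hs, sub_eq_zero] at h
      exact h.symm
    have h := γ.map_mem_decomposables hz
    have hγ : γ.toLin n p ((of Q').toLin n p z) = (of S.indecomposables).toLin n p y :=
      congrArg ((of S.indecomposables).toLin n p) hzy
    rw [map_sub, hγ] at h
    rw [weightGE_two_eq_decomposables]
    exact h
  refine ⟨lift t, fun n p => Function.Injective.of_comp (f := γ.toLin n p) (hφ n p), ?_⟩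
  let ψ : (FreeOperad S.indecomposables).Hom S :=
    ⟨(lift t).toHom.trans α'.toHom, fun h hd i f g => by
      simp only [GrCollection.Hom.trans, LinearMap.comp_apply, Hom.map_comp]⟩
  -- Both homomorphisms restrict to `s` on generators.
  have hψ : ψ = lift s := lift_unique s ψ ht
  intro n p y
  rw [← hψ]
  rfl

end FreeOperad

theorem mainTheorem12 {k : Type u} [Field k] [CharZero k] (S : NonunitalOperad.{u, v} k)
    (hS : S.IsReduced) :
    (∃ s : S.indecomposables.Hom S.toGrCollection, S.IsSection s) ∧
    ∀ s : S.indecomposables.Hom S.toGrCollection, S.IsSection s →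
      -- (i)
      (FreeOperad.lift s).IsEpi ∧
      -- (ii)
      (∀ n p, LinearMap.ker ((FreeOperad.lift s).toLin n p) ≤
          FreeOperad.weightGE S.indecomposables 2 n p) ∧
      (∀ n p, FreeOperad.weightGE S.indecomposables 2 n p =
          (FreeOperad S.indecomposables).decomposables n p) ∧
      -- (iii)
      ∀ Q' : GrCollection.{u, w} k, Q'.IsReduced →
        ∀ α' : (FreeOperad Q').Hom S, α'.IsEpi →
          ∃ β : (FreeOperad S.indecomposables).Hom (FreeOperad Q'), β.IsMono ∧
            ∀ n p (y : (FreeOperad S.indecomposables).obj n p),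
              α'.toLin n p (β.toLin n p y) = (FreeOperad.lift s).toLin n p y := by
  refine ⟨S.exists_isSection, fun s hs => ⟨FreeOperad.isEpi_lift hS hs, fun n p => ?_,
    FreeOperad.weightGE_two_eq_decomposables, fun Q' _ α' hα' =>
      FreeOperad.exists_isMono_lift hS hs α' hα'⟩⟩
  rw [FreeOperad.weightGE_two_eq_decomposables]
  exact FreeOperad.ker_lift_le_decomposables hs n p
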